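/- Theorem. Let $L^2(\mathbb R)$ be the complex Hilbert space of square-integrable functions on $\mathbb R$. There are one-to-one self-adjoint operators $A$ and $B$ in $L^2(\mathbb R)$, with $A$, $B$, $A^{-1}$, $B^{-1}$ all unbounded and $$D(A)\cap D(B)=D(A^{-1})\cap D(B^{-1})=\{0\},$$ such that the operator $$T=\begin{pmatrix}0&A^{-1}\\ B&0\end{pmatrix},\qquad T(x,y)=(A^{-1}y,\,Bx),\qquad D(T)=D(B)\oplus D(A^{-1}),$$ in the Hilbert space $L^2(\mathbb R)\oplus L^2(\mathbb R)$ has the following properties: $T$ is densely defined and closed; $T$ and $T^*$ are both one-to-one; $D(T^2)=D((T^*)^2)=\{0\}$; $T$ and $T^*$ are both paranormal; and $T$ is not normal. Here products of operators carry their natural domains, $D(SR)=\{x\in D(R): Rx\in D(S)\}$. An operator $S$ is paranormal if $\|Sx\|^2\le\|S^2x\|\,\|x\|$ for all $x\in D(S^2)$, and a densely defined operator $S$ is normal if it is closed and $SS^*=S^*S$. -/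

import Mathlib

noncomputable section

namespace UnboundedOperator

/-- The complex Hilbert space `L²(ℝ)` of square-integrable functions `ℝ → ℂ` modulo almost everywhere
equality. -/
abbrev L2R : Type := MeasureTheory.Lp ℂ 2 (MeasureTheory.volume : MeasureTheory.Measure ℝ)

/-- The Hilbert space direct sum `L²(ℝ) ⊕ L²(ℝ)`. -/
abbrev L2RSum : Type := WithLp 2 (L2R × L2R)

section Algebra

variable {E F G : Type*} [AddCommGroup E] [Module ℂ E] [AddCommGroup F] [Module ℂ F]
  [AddCommGroup G] [Module ℂ G]

/-- The product `S R` of two unbounded operators on its natural domain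
`D(S R) = {x ∈ D(R) : R x ∈ D(S)}`. -/
def mul (S : F →ₗ.[ℂ] G) (R : E →ₗ.[ℂ] F) : E →ₗ.[ℂ] G where
  domain :=
    { carrier := {x | ∃ hx : x ∈ R.domain, R ⟨x, hx⟩ ∈ S.domain}
      zero_mem' := ⟨R.domain.zero_mem, by
        have h : R ⟨0, R.domain.zero_mem⟩ = 0 := R.map_zero
        rw [h]
        exact S.domain.zero_mem⟩
      add_mem' := by
        rintro x y ⟨hx, hx'⟩ ⟨hy, hy'⟩
        refine ⟨R.domain.add_mem hx hy, ?_⟩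
        have h : R ⟨x + y, R.domain.add_mem hx hy⟩ = R ⟨x, hx⟩ + R ⟨y, hy⟩ :=
          R.map_add ⟨x, hx⟩ ⟨y, hy⟩
        rw [h]
        exact S.domain.add_mem hx' hy'
      smul_mem' := by
        rintro c x ⟨hx, hx'⟩
        refine ⟨R.domain.smul_mem c hx, ?_⟩
        have h : R ⟨c • x, R.domain.smul_mem c hx⟩ = c • R ⟨x, hx⟩ := R.map_smul c ⟨x, hx⟩
        rw [h]
        exact S.domain.smul_mem c hx' }
  toFun :=
    { toFun := fun x => S ⟨R ⟨x.1, x.2.choose⟩, x.2.choose_spec⟩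
      map_add' := fun x y => by
        rw [← S.map_add]
        congr 1
        exact Subtype.ext (R.map_add ⟨x.1, x.2.choose⟩ ⟨y.1, y.2.choose⟩)
      map_smul' := fun c x => by
        rw [RingHom.id_apply, ← S.map_smul]
        congr 1
        exact Subtype.ext (R.map_smul c ⟨x.1, x.2.choose⟩) }

theorem mem_mul_domain (S : F →ₗ.[ℂ] G) (R : E →ₗ.[ℂ] F) (x : E) :
    x ∈ (mul S R).domain ↔ ∃ hx : x ∈ R.domain, R ⟨x, hx⟩ ∈ S.domain :=
  Iff.rfl

theorem mul_apply (S : F →ₗ.[ℂ] G) (R : E →ₗ.[ℂ] F) (x : E) (hx : x ∈ R.domain)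
    (hx' : R ⟨x, hx⟩ ∈ S.domain) : mul S R ⟨x, hx, hx'⟩ = S ⟨R ⟨x, hx⟩, hx'⟩ :=
  rfl

/-- The operator matrix `(0, S; R, 0)` on the Hilbert sum `E ⊕ F`, that is
`(x, y) ↦ (S y, R x)`, with domain `D(R) ⊕ D(S)`. -/
def offDiagonal (S : F →ₗ.[ℂ] E) (R : E →ₗ.[ℂ] F) :
    WithLp 2 (E × F) →ₗ.[ℂ] WithLp 2 (E × F) where
  domain :=
    { carrier := {z | z.fst ∈ R.domain ∧ z.snd ∈ S.domain}
      zero_mem' := ⟨R.domain.zero_mem, S.domain.zero_mem⟩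
      add_mem' := fun hz hw => ⟨R.domain.add_mem hz.1 hw.1, S.domain.add_mem hz.2 hw.2⟩
      smul_mem' := fun c _ hz => ⟨R.domain.smul_mem c hz.1, S.domain.smul_mem c hz.2⟩ }
  toFun :=
    { toFun := fun z => WithLp.toLp 2 (S ⟨z.1.snd, z.2.2⟩, R ⟨z.1.fst, z.2.1⟩)
      map_add' := fun z w => by
        rw [← WithLp.toLp_add, Prod.mk_add_mk, ← S.map_add, ← R.map_add]
        rfl
      map_smul' := fun c z => by
        rw [RingHom.id_apply, ← WithLp.toLp_smul, Prod.smul_mk, ← S.map_smul, ← R.map_smul]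
        rfl }

theorem mem_offDiagonal_domain (S : F →ₗ.[ℂ] E) (R : E →ₗ.[ℂ] F) (z : WithLp 2 (E × F)) :
    z ∈ (offDiagonal S R).domain ↔ z.fst ∈ R.domain ∧ z.snd ∈ S.domain :=
  Iff.rfl

theorem offDiagonal_apply (S : F →ₗ.[ℂ] E) (R : E →ₗ.[ℂ] F) (z : (offDiagonal S R).domain) :
    offDiagonal S R z = WithLp.toLp 2 (S ⟨z.1.snd, z.2.2⟩, R ⟨z.1.fst, z.2.1⟩) :=
  rfl

end Algebra

section Normed

variable {H : Type*} [NormedAddCommGroup H] [InnerProductSpace ℂ H]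

/-- `T` is bounded on its domain. -/
def IsBounded (T : H →ₗ.[ℂ] H) : Prop :=
  ∃ C : ℝ, ∀ x : T.domain, ‖T x‖ ≤ C * ‖(x : H)‖

/-- `T` is paranormal: `‖T x‖² ≤ ‖T² x‖ ‖x‖` for all `x ∈ D(T²)`. -/
def IsParanormal (T : H →ₗ.[ℂ] H) : Prop :=
  ∀ (x : H) (hx : x ∈ T.domain) (hTx : T ⟨x, hx⟩ ∈ T.domain),
    ‖T ⟨x, hx⟩‖ ^ 2 ≤ ‖mul T T ⟨x, hx, hTx⟩‖ * ‖x‖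

/-- `T` is normal: densely defined, closed, and `T T* = T* T` (with equality of domains). -/
def IsNormal [CompleteSpace H] (T : H →ₗ.[ℂ] H) : Prop :=
  Dense (T.domain : Set H) ∧ T.IsClosed ∧ mul T T.adjoint = mul T.adjoint T

end Normed

end UnboundedOperator

end

/-!
The domains of `T²` and `(T*)²` vanish as soon as `D(A) ∩ D(B)` and `D(A⁻¹) ∩ D(B⁻¹)` do, because
the squares are diagonal with entries `A⁻¹ B` and `B A⁻¹`, and `T* = (0, B; A⁻¹, 0)` by
self-adjointness. Paranormality is then vacuous, and `A`, `B` and their inverses are unbounded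
because a bounded self-adjoint operator is everywhere defined. So everything rests on the
construction of `A` and `B`.

Let `W`, `S`, `P` be symmetric, everywhere defined operators on a Hilbert space `K` such that
`W w + S s + P p = 0` only for `w = s = p = 0`. On `K ⊕ K` take `A = P⁻¹ ⊕ P`, and let `B` be the
congruence `N⁻* (S⁻¹ ⊕ S) N⁻¹` of an operator of the same kind by the shear `N = (1, W; 0, 1)`. Then
`D(A) = {(P a, b)}` and `D(B) = {(S c + W d, d)}` meet trivially, and so do `D(A⁻¹) = {(a, P b)}` and
`D(B⁻¹) = {(c, S d - W c)}`. Self-adjointness is a computation with the parametrized graphs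
(`isSelfAdjointPair_shear`). Normality fails since `D(A⁻²)`, which contains `K ⊕ 0`, is not
contained in `D(B)`, where only the vectors of `ran S ⊕ 0` have second component zero.

For the three operators take `K = ℓ²(ℕ)` and the matrix `2^{-(n+1)(k+1)}`, which evaluates power
series at the points `2^{-(n+1)}`. Points of an infinite subset accumulate at `0`, so the image of
a nonzero sequence cannot vanish on any residue class modulo `3`. Conjugating by the multiplication
operator with values `1, 2, 3` on the three classes, once and twice, gives operators whose ranges
are independent, by a Vandermonde argument (`eq_zero_of_powerOp_add_residueMul_eq_zero`). Finally
`ℓ²(ℕ) ⊕ ℓ²(ℕ)` is isometrically isomorphic to `L²(ℝ)`, both being separable and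
infinite-dimensional.
-/

noncomputable section

namespace UnboundedOperator

/-! ### Unbounded operators -/

theorem isParanormal_of_domain_mul_eq_bot {H : Type*} [NormedAddCommGroup H]
    [InnerProductSpace ℂ H] {T : H →ₗ.[ℂ] H} (h : (mul T T).domain = ⊥) : IsParanormal T := by
  intro x hx hTx
  have hx0 : x = 0 := by
    have : x ∈ (mul T T).domain := ⟨hx, hTx⟩
    simpa [h] using this
  subst hx0
  have : T ⟨0, hx⟩ = 0 := T.map_zero
  simp [this]

section SelfAdjoint

variable {H : Type*} [NormedAddCommGroup H] [InnerProductSpace ℂ H] [CompleteSpace H]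

theorem dense_of_orthogonal_trivial {V : Submodule ℂ H}
    (h : ∀ a : H, (∀ y ∈ V, inner ℂ y a = 0) → a = 0) : Dense (V : Set H) := by
  rw [Submodule.dense_iff_topologicalClosure_eq_top, Submodule.topologicalClosure_eq_top_iff,
    Submodule.eq_bot_iff]
  exact fun a ha => h a fun y hy => Submodule.inner_right_of_mem_orthogonal hy ha

/-- A self-adjoint operator that is bounded on its domain is everywhere defined, because every
vector then lies in the domain of the adjoint. -/
theorem domain_eq_top_of_isBounded {A : H →ₗ.[ℂ] H} (hA : IsSelfAdjoint A) (hb : IsBounded A) :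
    A.domain = ⊤ := by
  obtain ⟨C, hC⟩ := hb
  rw [Submodule.eq_top_iff']
  intro y
  rw [← LinearPMap.isSelfAdjoint_def.mp hA, LinearPMap.mem_adjoint_domain_iff]
  exact (innerSL ℂ y).continuous.comp (A.toFun.mkContinuous C hC).continuous

theorem not_isBounded_of_domain_inf_eq_bot [Nontrivial H] {A B : H →ₗ.[ℂ] H}
    (hA : IsSelfAdjoint A) (hB : IsSelfAdjoint B) (hAB : A.domain ⊓ B.domain = ⊥) :
    ¬ IsBounded A := by
  intro hb
  rw [domain_eq_top_of_isBounded hA hb, top_inf_eq] at hAB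
  have hd := hB.dense_domain
  rw [hAB, Submodule.dense_iff_topologicalClosure_eq_top,
    Submodule.topologicalClosure_eq_top_iff, Submodule.bot_orthogonal_eq_top] at hd
  exact top_ne_bot hd

end SelfAdjoint

section OffDiagonal

variable {E F : Type*} [NormedAddCommGroup E] [InnerProductSpace ℂ E]
  [NormedAddCommGroup F] [InnerProductSpace ℂ F]

theorem mem_graph_offDiagonal (S : F →ₗ.[ℂ] E) (R : E →ₗ.[ℂ] F) (z w : WithLp 2 (E × F)) :
    (z, w) ∈ (offDiagonal S R).graph ↔
      (z.snd, w.fst) ∈ S.graph ∧ (z.fst, w.snd) ∈ R.graph := by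
  constructor
  · intro h
    obtain ⟨⟨y, hy⟩, rfl, rfl⟩ := (LinearPMap.mem_graph_iff _).1 h
    exact ⟨S.mem_graph ⟨y.snd, hy.2⟩, R.mem_graph ⟨y.fst, hy.1⟩⟩
  · rintro ⟨hS, hR⟩
    obtain ⟨⟨s, hs⟩, hs1, hs2⟩ := (LinearPMap.mem_graph_iff _).1 hS
    obtain ⟨⟨r, hr⟩, hr1, hr2⟩ := (LinearPMap.mem_graph_iff _).1 hR
    dsimp only at hs1 hs2 hr1 hr2
    subst hs1 hr1
    refine (LinearPMap.mem_graph_iff _).2 ⟨⟨z, hr, hs⟩, rfl, ?_⟩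
    refine WithLp.ofLp_injective 2 (Prod.ext hs2 hr2)

theorem dense_domain_offDiagonal [CompleteSpace E] [CompleteSpace F] {S : F →ₗ.[ℂ] E}
    {R : E →ₗ.[ℂ] F} (hS : Dense (S.domain : Set F)) (hR : Dense (R.domain : Set E)) :
    Dense ((offDiagonal S R).domain : Set (WithLp 2 (E × F))) := by
  refine dense_of_orthogonal_trivial fun a ha => ?_
  refine WithLp.ofLp_injective 2 (Prod.ext ?_ ?_)
  · refine hR.eq_zero_of_inner_right ℂ fun v hv => ?_
    simpa using ha (WithLp.toLp 2 (v, 0)) ⟨hv, S.domain.zero_mem⟩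
  · refine hS.eq_zero_of_inner_right ℂ fun v hv => ?_
    simpa using ha (WithLp.toLp 2 (0, v)) ⟨R.domain.zero_mem, hv⟩

theorem adjoint_offDiagonal [CompleteSpace E] [CompleteSpace F] {S : F →ₗ.[ℂ] E}
    {R : E →ₗ.[ℂ] F} (hS : Dense (S.domain : Set F)) (hR : Dense (R.domain : Set E)) :
    (offDiagonal S R).adjoint = offDiagonal R.adjoint S.adjoint := by
  apply LinearPMap.eq_of_eq_graph
  ext ⟨p, q⟩
  rw [mem_graph_offDiagonal, LinearPMap.adjoint_graph_eq_graph_adjoint hS,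
    LinearPMap.adjoint_graph_eq_graph_adjoint hR,
    LinearPMap.adjoint_graph_eq_graph_adjoint (dense_domain_offDiagonal hS hR)]
  simp only [Submodule.mem_adjoint_iff]
  constructor
  · intro h
    constructor
    · intro a b hab
      simpa using h (WithLp.toLp 2 (a, 0)) (WithLp.toLp 2 (0, b))
        ((mem_graph_offDiagonal _ _ _ _).2 ⟨S.graph.zero_mem, hab⟩)
    · intro a b hab
      simpa using h (WithLp.toLp 2 (0, a)) (WithLp.toLp 2 (b, 0))
        ((mem_graph_offDiagonal _ _ _ _).2 ⟨hab, R.graph.zero_mem⟩)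
  · rintro ⟨hR', hS'⟩ a b hab
    obtain ⟨h1, h2⟩ := (mem_graph_offDiagonal _ _ _ _).1 hab
    have e1 := sub_eq_zero.1 (hS' _ _ h1)
    have e2 := sub_eq_zero.1 (hR' _ _ h2)
    simp only [WithLp.prod_inner_apply, WithLp.ofLp_fst, WithLp.ofLp_snd]
    rw [e1, e2]
    ring

theorem injective_offDiagonal {S : F →ₗ.[ℂ] E} {R : E →ₗ.[ℂ] F}
    (hS : Function.Injective S.toFun) (hR : Function.Injective R.toFun) :
    Function.Injective (offDiagonal S R).toFun := by
  rintro ⟨z, hz⟩ ⟨w, hw⟩ h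
  have h1 : S ⟨z.snd, hz.2⟩ = S ⟨w.snd, hw.2⟩ := congrArg WithLp.fst h
  have h2 : R ⟨z.fst, hz.1⟩ = R ⟨w.fst, hw.1⟩ := congrArg WithLp.snd h
  exact Subtype.ext (WithLp.ofLp_injective 2
    (Prod.ext (congrArg Subtype.val (hR h2)) (congrArg Subtype.val (hS h1))))

/-- The square of `(0, S; R, 0)` is diagonal with entries `S R` and `R S`; its domain is trivial as
soon as the range of each entry meets the domain of the other one trivially. -/
theorem domain_mul_offDiagonal_eq_bot {S : F →ₗ.[ℂ] E} {R : E →ₗ.[ℂ] F}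
    (hS : Function.Injective S.toFun) (hR : Function.Injective R.toFun)
    (hRS : LinearMap.range R.toFun ⊓ S.domain = ⊥)
    (hSR : LinearMap.range S.toFun ⊓ R.domain = ⊥) :
    (mul (offDiagonal S R) (offDiagonal S R)).domain = ⊥ := by
  rw [Submodule.eq_bot_iff]
  rintro z ⟨hz, hz1, hz2⟩
  have h1 : S.toFun ⟨z.snd, hz.2⟩ = 0 := by
    rw [← Submodule.mem_bot ℂ, ← hSR]
    exact ⟨⟨_, rfl⟩, hz1⟩
  have h2 : R.toFun ⟨z.fst, hz.1⟩ = 0 := by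
    rw [← Submodule.mem_bot ℂ, ← hRS]
    exact ⟨⟨_, rfl⟩, hz2⟩
  refine WithLp.ofLp_injective 2 (Prod.ext ?_ ?_)
  · exact congrArg Subtype.val (hR (h2.trans (map_zero _).symm))
  · exact congrArg Subtype.val (hS (h1.trans (map_zero _).symm))

end OffDiagonal

/-! ### Operators given by a parametrized graph -/

section Quotient

variable {M H : Type*} [AddCommGroup M] [Module ℂ M] [NormedAddCommGroup H]
  [InnerProductSpace ℂ H]

/-- The operator `Y w ↦ X w` with domain the range of `Y`, i.e. `X Y⁻¹`. It is the operator whose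
graph is `{(Y w, X w)}`, which is meaningful when `Y` is injective. -/
def quotient (Y X : M →ₗ[ℂ] H) : H →ₗ.[ℂ] H :=
  (LinearMap.range (Y.prod X)).toLinearPMap

theorem mem_domain_quotient (Y X : M →ₗ[ℂ] H) (y : H) :
    y ∈ (quotient Y X).domain ↔ ∃ w, Y w = y := by
  simp [quotient, Submodule.toLinearPMap_domain]

theorem mem_graph_quotient {Y : M →ₗ[ℂ] H} (hY : Function.Injective Y) (X : M →ₗ[ℂ] H)
    (p : H × H) : p ∈ (quotient Y X).graph ↔ ∃ w, Y w = p.1 ∧ X w = p.2 := by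
  rw [quotient, Submodule.toLinearPMap_graph_eq]
  · simp [Prod.ext_iff]
  · rintro x ⟨w, rfl⟩ h
    have : w = 0 := hY (by simpa using h)
    simp [this]

theorem quotient_apply {Y : M →ₗ[ℂ] H} (hY : Function.Injective Y) (X : M →ₗ[ℂ] H) (w : M)
    (hw : Y w ∈ (quotient Y X).domain) : quotient Y X ⟨Y w, hw⟩ = X w :=
  ((LinearPMap.image_iff hw).2 ((mem_graph_quotient hY X _).2 ⟨w, rfl, rfl⟩)).symm

theorem injective_quotient {Y X : M →ₗ[ℂ] H} (hY : Function.Injective Y)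
    (hX : Function.Injective X) : Function.Injective (quotient Y X).toFun := by
  rintro ⟨y, hy⟩ ⟨z, hz⟩ h
  obtain ⟨v, rfl⟩ := (mem_domain_quotient Y X y).1 hy
  obtain ⟨w, rfl⟩ := (mem_domain_quotient Y X z).1 hz
  have h' : X v = X w := by
    rw [← quotient_apply hY X v hy, ← quotient_apply hY X w hz]
    exact h
  simp [hX h']

theorem inverse_quotient {Y X : M →ₗ[ℂ] H} (hY : Function.Injective Y)
    (hX : Function.Injective X) : (quotient Y X).inverse = quotient X Y := by
  apply LinearPMap.eq_of_eq_graph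
  rw [LinearPMap.inverse_graph (LinearMap.ker_eq_bot.2 (injective_quotient hY hX))]
  ext ⟨a, b⟩
  simp [mem_graph_quotient hY, mem_graph_quotient hX, and_comm]

/-- The graph `{(Y w, X w)}` equals its own adjoint relation. -/
def IsSelfAdjointPair (Y X : M →ₗ[ℂ] H) : Prop :=
  ∀ y z : H, (∀ w, inner ℂ (X w) y = inner ℂ (Y w) z) ↔ ∃ w, Y w = y ∧ X w = z

theorem IsSelfAdjointPair.swap {Y X : M →ₗ[ℂ] H} (h : IsSelfAdjointPair Y X) :
    IsSelfAdjointPair X Y := by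
  intro y z
  simpa only [eq_comm, and_comm] using h z y

/-- Density of the domain is automatic: if `a` is orthogonal to the range of `Y`, then `(0, a)`
lies in the adjoint relation, hence in the graph, so `a = 0`. -/
theorem IsSelfAdjointPair.isSelfAdjoint [CompleteSpace H] {Y X : M →ₗ[ℂ] H}
    (h : IsSelfAdjointPair Y X) (hY : Function.Injective Y) : IsSelfAdjoint (quotient Y X) := by
  have hd : Dense ((quotient Y X).domain : Set H) := by
    refine dense_of_orthogonal_trivial fun a ha => ?_
    obtain ⟨w, hw, rfl⟩ := (h 0 a).1 fun w => by
      rw [inner_zero_right, ha _ ((mem_domain_quotient _ _ _).2 ⟨w, rfl⟩)]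
    rw [hY (hw.trans (map_zero Y).symm), map_zero]
  rw [LinearPMap.isSelfAdjoint_def]
  apply LinearPMap.eq_of_eq_graph
  rw [LinearPMap.adjoint_graph_eq_graph_adjoint hd]
  ext ⟨y, z⟩
  rw [mem_graph_quotient hY, Submodule.mem_adjoint_iff, ← h]
  simp only [mem_graph_quotient hY, forall_exists_index, and_imp, sub_eq_zero]
  exact ⟨fun H w => H _ _ w rfl rfl, fun H a b w ha hb => by subst ha hb; exact H w⟩

end Quotient

/-! ### Congruence of diagonal operators -/

section Congruence

variable {K H : Type*} [NormedAddCommGroup K] [InnerProductSpace ℂ K]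
  [NormedAddCommGroup H] [InnerProductSpace ℂ H]

/-- The map `(u, v) ↦ (S u + W v, v)`, carried to `H` by `J`: the product of the shear with entry
`W` and of `S ⊕ 1`. -/
def shearDomain (J : WithLp 2 (K × K) ≃ₗᵢ[ℂ] H) (S W : K →ₗ[ℂ] K) : K × K →ₗ[ℂ] H :=
  J.toLinearEquiv.toLinearMap ∘ₗ (WithLp.linearEquiv 2 ℂ (K × K)).symm.toLinearMap ∘ₗ
    (S.coprod W).prod (LinearMap.snd ℂ K K)

/-- The map `(u, v) ↦ (u, S v - W u)`, carried to `H` by `J`: for symmetric `W`, the product of the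
inverse adjoint of the shear with entry `W` and of `1 ⊕ S`. -/
def shearRange (J : WithLp 2 (K × K) ≃ₗᵢ[ℂ] H) (S W : K →ₗ[ℂ] K) : K × K →ₗ[ℂ] H :=
  J.toLinearEquiv.toLinearMap ∘ₗ (WithLp.linearEquiv 2 ℂ (K × K)).symm.toLinearMap ∘ₗ
    (LinearMap.fst ℂ K K).prod ((-W).coprod S)

variable (J : WithLp 2 (K × K) ≃ₗᵢ[ℂ] H) {S W : K →ₗ[ℂ] K}

theorem shearDomain_apply (S W : K →ₗ[ℂ] K) (w : K × K) :
    shearDomain J S W w = J (WithLp.toLp 2 (S w.1 + W w.2, w.2)) :=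
  rfl

theorem shearRange_apply (S W : K →ₗ[ℂ] K) (w : K × K) :
    shearRange J S W w = J (WithLp.toLp 2 (w.1, S w.2 - W w.1)) := by
  rw [sub_eq_neg_add]
  rfl

theorem toLp_inj {a b c d : K} :
    J (WithLp.toLp 2 (a, b)) = J (WithLp.toLp 2 (c, d)) ↔ a = c ∧ b = d := by
  simp

theorem injective_shearDomain (hS : Function.Injective S) (W : K →ₗ[ℂ] K) :
    Function.Injective (shearDomain J S W) := by
  rintro ⟨u, v⟩ ⟨u', v'⟩ h
  simp only [shearDomain_apply, toLp_inj] at h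
  obtain ⟨h, rfl⟩ := h
  rw [hS (add_right_cancel h)]

theorem injective_shearRange (hS : Function.Injective S) (W : K →ₗ[ℂ] K) :
    Function.Injective (shearRange J S W) := by
  rintro ⟨u, v⟩ ⟨u', v'⟩ h
  simp only [shearRange_apply, toLp_inj] at h
  obtain ⟨rfl, h⟩ := h
  rw [hS (sub_left_inj.1 h)]

theorem isSelfAdjointPair_shear (hS : S.IsSymmetric) (hW : W.IsSymmetric) :
    IsSelfAdjointPair (shearDomain J S W) (shearRange J S W) := by
  intro y z
  obtain ⟨y, rfl⟩ := J.surjective y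
  obtain ⟨z, rfl⟩ := J.surjective z
  constructor
  · intro h
    simp only [Prod.forall, shearDomain_apply, shearRange_apply, J.inner_map_map,
      WithLp.prod_inner_apply] at h
    -- Testing against `(u, 0)` and `(0, v)` gives the two components of the relation.
    have h₁ : y.fst - W y.snd = S z.fst := by
      refine ext_inner_left ℂ fun u => ?_
      have := h u 0
      simp only [map_zero, zero_sub, add_zero, inner_neg_left, inner_zero_left, hW u, hS u] at this
      rw [inner_sub_right, sub_eq_add_neg]
      exact this
    have h₂ : S y.snd = W z.fst + z.snd := by
      refine ext_inner_left ℂ fun v => ?_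
      have := h 0 v
      simp only [map_zero, sub_zero, zero_add, inner_zero_left, hW v, hS v] at this
      rw [inner_add_right]
      exact this
    refine ⟨(z.fst, y.snd), ?_, ?_⟩
    · rw [shearDomain_apply, ← h₁, sub_add_cancel]
      rfl
    · rw [shearRange_apply, h₂, add_sub_cancel_left]
      rfl
  · rintro ⟨⟨u, v⟩, hy, hz⟩ ⟨u', v'⟩
    rw [← hy, ← hz]
    simp only [shearDomain_apply, shearRange_apply, J.inner_map_map, WithLp.prod_inner_apply,
      inner_add_left, inner_sub_left, inner_add_right, inner_sub_right, hS _ _, hW _ _]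
    ring

end Congruence

/-! ### Three symmetric operators with independent ranges -/

/-- The entry `2^{-(n+1)(k+1)}` of a symmetric matrix. Its `n`-th row is the sequence of powers
`x, x², …` of `x = 2^{-(n+1)}`, so that the matrix evaluates power series at these points. -/
def powerEntry (n k : ℕ) : ℂ := (1 / 2) ^ ((n + 1) * (k + 1))

theorem powerEntry_comm (n k : ℕ) : powerEntry n k = powerEntry k n := by
  rw [powerEntry, powerEntry, mul_comm]

theorem powerEntry_ne_zero (n k : ℕ) : powerEntry n k ≠ 0 :=
  pow_ne_zero _ (by norm_num)

theorem powerEntry_add (n k i : ℕ) :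
    powerEntry n (i + (k + 1)) = powerEntry n k * powerEntry n i := by
  rw [powerEntry, powerEntry, powerEntry, ← pow_add]
  ring_nf

theorem conj_powerEntry (n k : ℕ) : (starRingEnd ℂ) (powerEntry n k) = powerEntry n k := by
  rw [powerEntry, map_pow, map_div₀, map_one, Complex.conj_ofNat]

theorem norm_powerEntry_mul_le {z : ℂ} {C : ℝ} (hz : ‖z‖ ≤ C) (n k : ℕ) :
    ‖powerEntry n k * z‖ ≤ (1 / 2) ^ n * C * (1 / 2) ^ k := by
  have hC : 0 ≤ C := (norm_nonneg z).trans hz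
  have h : ‖powerEntry n k‖ ≤ (1 / 2) ^ n * (1 / 2) ^ k := by
    have : ((1 : ℝ) / 2) ^ ((n + 1) * (k + 1)) ≤ (1 / 2) ^ (n + k) :=
      pow_le_pow_of_le_one (by norm_num) (by norm_num) (by nlinarith)
    rw [← pow_add]
    simpa [powerEntry] using this
  rw [norm_mul, mul_right_comm]
  gcongr

theorem summable_powerEntry_mul {a : ℕ → ℂ} {C : ℝ} (ha : ∀ k, ‖a k‖ ≤ C) (n : ℕ) :
    Summable fun k => powerEntry n k * a k :=
  (summable_geometric_two.mul_left ((1 / 2) ^ n * C)).of_norm_bounded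
    fun k => norm_powerEntry_mul_le (ha k) n k

theorem norm_tsum_powerEntry_mul_le {a : ℕ → ℂ} {C : ℝ} (ha : ∀ k, ‖a k‖ ≤ C) (n : ℕ) :
    ‖∑' k, powerEntry n k * a k‖ ≤ (1 / 2) ^ n * C * 2 :=
  tsum_of_norm_bounded (hasSum_geometric_two.mul_left ((1 / 2) ^ n * C))
    fun k => norm_powerEntry_mul_le (ha k) n k

/-- A power series with bounded coefficients that vanishes at infinitely many of the points
`2^{-(n+1)}`, which accumulate at `0`, is zero. -/
theorem eq_zero_of_frequently_tsum_eq_zero {a : ℕ → ℂ} {C : ℝ} (ha : ∀ k, ‖a k‖ ≤ C)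
    (h : ∃ᶠ n in Filter.atTop, ∑' k, powerEntry n k * a k = 0) (k : ℕ) : a k = 0 := by
  induction k using Nat.strong_induction_on with
  | _ k ih =>
    by_contra hk
    -- If `a k` is the first nonzero coefficient, the remaining terms are too small near `0`.
    have hlim : Filter.Tendsto (fun n : ℕ => ((1 : ℝ) / 2) ^ n * C * 2) Filter.atTop (nhds 0) := by
      have := ((tendsto_pow_atTop_nhds_zero_of_lt_one (r := (1 : ℝ) / 2) (by norm_num)
        (by norm_num)).mul_const C).mul_const 2
      simpa using this
    obtain ⟨n, hn, hlt⟩ := (h.and_eventually (hlim.eventually_lt_const (norm_pos_iff.2 hk))).exists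
    rw [← (summable_powerEntry_mul ha n).sum_add_tsum_nat_add (k + 1), Finset.sum_range_succ,
      Finset.sum_eq_zero fun i hi => by rw [ih i (Finset.mem_range.1 hi), mul_zero], zero_add] at hn
    simp only [powerEntry_add, mul_assoc, tsum_mul_left] at hn
    rw [← mul_add, mul_eq_zero, or_iff_right (powerEntry_ne_zero n k)] at hn
    have hle := norm_tsum_powerEntry_mul_le (fun i => ha (i + (k + 1))) n
    rw [← norm_neg, ← eq_neg_of_add_eq_zero_left hn] at hle
    exact absurd hle (not_le.2 hlt)

/-- The Hilbert space `ℓ²(ℕ)`. -/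
abbrev SeqSpace : Type := lp (fun _ : ℕ => ℂ) 2

theorem norm_apply_le (u : SeqSpace) (k : ℕ) : ‖u k‖ ≤ ‖u‖ :=
  lp.norm_apply_le_norm two_ne_zero u k

/-- The operator on `ℓ²(ℕ)` with matrix `powerEntry`. -/
def powerOp : SeqSpace →ₗ[ℂ] SeqSpace where
  toFun u := ⟨fun n => ∑' k, powerEntry n k * u k, by
    refine Memℓp.mono (g := fun n : ℕ => ((1 : ℝ) / 2) ^ n * ‖u‖ * 2) ?_
      fun n => norm_tsum_powerEntry_mul_le (norm_apply_le u) n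
    refine memℓp_gen ?_
    have hs : Summable fun n : ℕ => ((1 : ℝ) / 4) ^ n * (‖u‖ * 2) ^ 2 :=
      (summable_geometric_of_lt_one (by norm_num) (by norm_num)).mul_right _
    refine hs.congr fun n => ?_
    rw [ENNReal.toReal_ofNat, Real.rpow_ofNat, mul_assoc, Real.norm_eq_abs, sq_abs, mul_pow _ (‖u‖ * 2),
      ← pow_mul, mul_comm n 2, pow_mul]
    norm_num⟩
  map_add' u v := by
    ext n
    simp only [lp.coeFn_add, Pi.add_apply, mul_add]
    exact (summable_powerEntry_mul (norm_apply_le u) n).tsum_add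
      (summable_powerEntry_mul (norm_apply_le v) n)
  map_smul' c u := by
    ext n
    simp only [lp.coeFn_smul, Pi.smul_apply, smul_eq_mul, RingHom.id_apply, mul_left_comm _ c,
      tsum_mul_left]

theorem powerOp_apply (u : SeqSpace) (n : ℕ) : powerOp u n = ∑' k, powerEntry n k * u k :=
  rfl

theorem powerOp_isSymmetric : powerOp.IsSymmetric := by
  intro u v
  rw [lp.inner_eq_tsum, lp.inner_eq_tsum]
  have hs : Summable (Function.uncurry fun n k : ℕ =>
      v n * (powerEntry n k * (starRingEnd ℂ) (u k))) := by
    refine ((summable_geometric_two.mul_of_nonneg summable_geometric_two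
      (fun n => by positivity) (fun n => by positivity)).mul_left (‖v‖ * ‖u‖)).of_norm_bounded ?_
    rintro ⟨n, k⟩
    rw [Function.uncurry_apply_pair, norm_mul]
    calc _ ≤ ‖v‖ * ((1 / 2) ^ n * ‖u‖ * (1 / 2) ^ k) := by
          gcongr
          · exact norm_apply_le v n
          · exact norm_powerEntry_mul_le (by simpa using norm_apply_le u k) n k
      _ = _ := by ring
  have h₁ (n : ℕ) : inner ℂ (powerOp u n) (v n) =
      ∑' k, v n * (powerEntry n k * (starRingEnd ℂ) (u k)) := by
    rw [tsum_mul_left, RCLike.inner_apply, powerOp_apply, Complex.conj_tsum]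
    simp only [map_mul, conj_powerEntry]
  have h₂ (k : ℕ) : inner ℂ (u k) (powerOp v k) =
      ∑' n, v n * (powerEntry n k * (starRingEnd ℂ) (u k)) := by
    rw [RCLike.inner_apply, powerOp_apply, ← tsum_mul_right]
    refine tsum_congr fun n => ?_
    rw [powerEntry_comm]
    ring
  simp only [h₁, h₂]
  exact hs.tsum_comm.symm

/-- Multiplication by the sequence `n % 3 + 1`, which is constant on each of the three residue
classes modulo `3` and takes distinct values `1, 2, 3` there. -/
def residueMul : SeqSpace →ₗ[ℂ] SeqSpace where
  toFun u := ⟨fun n => ((n % 3 : ℕ) + 1 : ℂ) * u n, by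
    refine Memℓp.mono' (lp.memℓp ((3 : ℂ) • u)) fun n => ?_
    rw [lp.coeFn_smul, Pi.smul_apply, norm_smul, norm_mul]
    gcongr
    have : n % 3 + 1 ≤ 3 := by omega
    rw [← Nat.cast_succ, Complex.norm_natCast, Complex.norm_ofNat]
    exact_mod_cast this⟩
  map_add' u v := by
    ext n
    exact mul_add _ _ _
  map_smul' c u := by
    ext n
    exact mul_left_comm _ _ _

theorem residueMul_apply (u : SeqSpace) (n : ℕ) :
    residueMul u n = ((n % 3 : ℕ) + 1 : ℂ) * u n :=
  rfl

theorem residueMul_isSymmetric : residueMul.IsSymmetric := by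
  intro u v
  rw [lp.inner_eq_tsum, lp.inner_eq_tsum]
  refine tsum_congr fun n => ?_
  rw [residueMul_apply, residueMul_apply, RCLike.inner_apply, RCLike.inner_apply, map_mul, map_add,
    map_one, Complex.conj_natCast]
  ring

theorem injective_residueMul : Function.Injective residueMul := by
  rw [injective_iff_map_eq_zero]
  intro u hu
  ext n
  have h : residueMul u n = 0 := by rw [hu]; rfl
  rw [residueMul_apply, mul_eq_zero, or_iff_right (Nat.cast_add_one_ne_zero _)] at h
  exact h

theorem eq_zero_of_frequently_powerOp_eq_zero {u : SeqSpace}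
    (h : ∃ᶠ n in Filter.atTop, powerOp u n = 0) : u = 0 := by
  ext k
  exact eq_zero_of_frequently_tsum_eq_zero (norm_apply_le u) h k

/-- On a residue class modulo `3` the operator `residueMul` is a scalar, so the hypothesis says that
a single combination of `u, v, w` is annihilated by `powerOp` along that class, hence is zero. The
three combinations form a Vandermonde system. -/
theorem eq_zero_of_powerOp_add_residueMul_eq_zero {u v w : SeqSpace}
    (h : powerOp u + residueMul (powerOp v) + residueMul (residueMul (powerOp w)) = 0) :
    u = 0 ∧ v = 0 ∧ w = 0 := by
  have key (i : ℕ) (hi : i < 3) : u + (i + 1 : ℂ) • v + (i + 1 : ℂ) ^ 2 • w = 0 := by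
    refine eq_zero_of_frequently_powerOp_eq_zero ?_
    rw [Filter.frequently_atTop]
    intro N
    refine ⟨3 * N + i, by omega, ?_⟩
    have hn := congrArg (fun f : SeqSpace => f (3 * N + i)) h
    simp only [lp.coeFn_add, Pi.add_apply, residueMul_apply, lp.coeFn_zero, Pi.zero_apply,
      show (3 * N + i) % 3 = i by omega] at hn
    simp only [map_add, map_smul, lp.coeFn_add, lp.coeFn_smul, Pi.add_apply, Pi.smul_apply,
      smul_eq_mul]
    rw [← hn]
    ring
  have h0 := key 0 (by norm_num)
  have h1 := key 1 (by norm_num)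
  have h2 := key 2 (by norm_num)
  norm_num at h0 h1 h2
  have hw : (2 : ℂ) • w = 0 := by
    have : (2 : ℂ) • w = (u + v + w) - (2 : ℂ) • (u + (2 : ℂ) • v + (4 : ℂ) • w) +
        (u + (3 : ℂ) • v + (9 : ℂ) • w) := by module
    rw [this, h0, h1, h2, smul_zero, sub_zero, add_zero]
  have hw0 : w = 0 := (smul_eq_zero.1 hw).resolve_left two_ne_zero
  have hv : v = 0 := by
    rw [hw0] at h0 h1
    have : v = (u + (2 : ℂ) • v + (4 : ℂ) • (0 : SeqSpace)) - (u + v + 0) := by module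
    rw [this, h0, h1, sub_zero]
  refine ⟨?_, hv, hw0⟩
  simpa [hv, hw0] using h0

theorem _root_.LinearMap.IsSymmetric.conj_self {E : Type*} [NormedAddCommGroup E] [InnerProductSpace ℂ E]
    {D T : E →ₗ[ℂ] E} (hD : D.IsSymmetric) (hT : T.IsSymmetric) :
    (D ∘ₗ T ∘ₗ D).IsSymmetric := fun x y => by
  simp only [LinearMap.comp_apply, hD _ _, hT _ _]

/-- There are three symmetric operators on `ℓ²(ℕ)` whose ranges are independent; in
particular they are injective. -/
theorem exists_isSymmetric_independent : ∃ W S P : SeqSpace →ₗ[ℂ] SeqSpace,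
    W.IsSymmetric ∧ S.IsSymmetric ∧ P.IsSymmetric ∧
      ∀ w s p, W w + S s + P p = 0 → w = 0 ∧ s = 0 ∧ p = 0 := by
  refine ⟨powerOp, residueMul ∘ₗ powerOp ∘ₗ residueMul,
    residueMul ∘ₗ (residueMul ∘ₗ powerOp ∘ₗ residueMul) ∘ₗ residueMul, powerOp_isSymmetric,
    residueMul_isSymmetric.conj_self powerOp_isSymmetric,
    residueMul_isSymmetric.conj_self (residueMul_isSymmetric.conj_self powerOp_isSymmetric), ?_⟩
  intro w s p h
  obtain ⟨hw, hs, hp⟩ := eq_zero_of_powerOp_add_residueMul_eq_zero h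
  exact ⟨hw, injective_residueMul (by simpa using hs),
    injective_residueMul (injective_residueMul (by simpa using hp))⟩

/-! ### Separable infinite-dimensional Hilbert spaces -/

theorem countable_of_orthonormal {ι E : Type*} [NormedAddCommGroup E] [InnerProductSpace ℂ E]
    [TopologicalSpace.SeparableSpace E] {v : ι → E} (hv : Orthonormal ℂ v) : Countable ι := by
  refine Pairwise.countable_of_isOpen_disjoint (s := fun i => Metric.ball (v i) (1 / 2)) ?_
    (fun i => Metric.isOpen_ball) fun i => ⟨v i, Metric.mem_ball_self (by norm_num)⟩
  intro i j hij
  refine Metric.ball_disjoint_ball ?_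
  have h : ‖v i - v j‖ ^ 2 = 2 := by
    rw [@norm_sub_sq ℂ, hv.1 i, hv.1 j, hv.2 hij]
    norm_num
  rw [dist_eq_norm]
  nlinarith [norm_nonneg (v i - v j)]

theorem exists_hilbertBasis_nat {E : Type*} [NormedAddCommGroup E] [InnerProductSpace ℂ E]
    [CompleteSpace E] [TopologicalSpace.SeparableSpace E] (hE : ¬ FiniteDimensional ℂ E) :
    Nonempty (HilbertBasis ℕ ℂ E) := by
  obtain ⟨w, b, -⟩ := exists_hilbertBasis ℂ E
  have : Countable w := countable_of_orthonormal b.orthonormal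
  have : Infinite w := by
    by_contra hw
    rw [not_infinite_iff_finite] at hw
    have := Fintype.ofFinite w
    exact hE b.toOrthonormalBasis.toBasis.finiteDimensional_of_finite
  obtain ⟨e⟩ := nonempty_equiv_of_countable (α := ℕ) (β := w)
  refine ⟨HilbertBasis.mk (b.orthonormal.comp e e.injective) ?_⟩
  rw [e.surjective.range_comp, b.dense_span]

theorem not_finiteDimensional_L2R : ¬ FiniteDimensional ℂ L2R := by
  intro h
  have hfin (n : ℕ) : MeasureTheory.volume (Set.Ico (n : ℝ) (n + 1)) ≠ ⊤ := by simp
  let v : ℕ → L2R := fun n => MeasureTheory.indicatorConstLp 2 measurableSet_Ico (hfin n) (1 : ℂ)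
  have hv : Orthonormal ℂ v := by
    rw [orthonormal_iff_ite]
    intro i j
    rw [MeasureTheory.L2.inner_indicatorConstLp_one,
      MeasureTheory.setIntegral_indicatorConstLp measurableSet_Ico]
    split_ifs with hij
    · subst hij
      simp
    · have : Set.Ico (j : ℝ) (j + 1) ∩ Set.Ico (i : ℝ) (i + 1) = ∅ := by
        ext x
        simp only [Set.mem_inter_iff, Set.mem_Ico, Set.mem_empty_iff_false, iff_false]
        rintro ⟨⟨h1, h2⟩, h3, h4⟩
        have a : (j : ℝ) < i + 1 := by linarith
        have b : (i : ℝ) < j + 1 := by linarith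
        norm_cast at a b
        omega
      simp [this]
  exact not_finite_iff_infinite.2 inferInstance hv.linearIndependent.finite

/-- All separable infinite-dimensional Hilbert spaces are isometrically isomorphic; here for
`ℓ²(ℕ) ⊕ ℓ²(ℕ)` and `L²(ℝ)`. -/
theorem exists_linearIsometryEquiv_L2R :
    Nonempty (WithLp 2 (SeqSpace × SeqSpace) ≃ₗᵢ[ℂ] L2R) := by
  have : Fact ((2 : ENNReal) ≠ ⊤) := ⟨ENNReal.ofNat_ne_top⟩
  obtain ⟨b⟩ := exists_hilbertBasis_nat not_finiteDimensional_L2R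
  have : SecondCountableTopology SeqSpace :=
    b.repr.symm.toHomeomorph.isEmbedding.secondCountableTopology
  have hinf : ¬ FiniteDimensional ℂ
      (WithLp 2 (SeqSpace × SeqSpace)) := by
    intro h
    let f : L2R →ₗ[ℂ] WithLp 2 (SeqSpace × SeqSpace) :=
      { toFun := fun u => WithLp.toLp 2 (b.repr u, 0)
        map_add' := fun u v => by rw [← WithLp.toLp_add, Prod.mk_add_mk, map_add, add_zero]
        map_smul' := fun c u => by
          rw [RingHom.id_apply, ← WithLp.toLp_smul, Prod.smul_mk, map_smul, smul_zero] }
    refine not_finiteDimensional_L2R (FiniteDimensional.of_injective f fun u v huv => ?_)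
    exact b.repr.injective (congrArg WithLp.fst huv)
  obtain ⟨b'⟩ := exists_hilbertBasis_nat hinf
  exact ⟨b'.repr.trans b.repr.symm⟩

/-! ### The pair of operators and the operator matrix -/

/-- Two self-adjoint operators `A`, `B` such that the domains of `A` and `B`, and those of their
inverses, meet trivially. The last clause provides a vector of `D((A⁻¹)²)` outside `D(B)`, which
separates the domains of `T T*` and `T* T` for the matrix `T = (0, A⁻¹; B, 0)`. -/
theorem exists_selfAdjoint_pair : ∃ A B : L2R →ₗ.[ℂ] L2R,
    IsSelfAdjoint A ∧ Function.Injective A.toFun ∧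
    IsSelfAdjoint A.inverse ∧ Function.Injective A.inverse.toFun ∧
    IsSelfAdjoint B ∧ Function.Injective B.toFun ∧
    IsSelfAdjoint B.inverse ∧
    A.domain ⊓ B.domain = ⊥ ∧ A.inverse.domain ⊓ B.inverse.domain = ⊥ ∧
    ∃ x ∈ (mul A.inverse A.inverse).domain, x ∉ B.domain := by
  obtain ⟨W, S, P, hW, hS, hP, hind⟩ := exists_isSymmetric_independent
  obtain ⟨J⟩ := exists_linearIsometryEquiv_L2R
  have hSinj : Function.Injective S := by
    rw [injective_iff_map_eq_zero]
    intro s hs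
    exact (hind 0 s 0 (by simp [hs])).2.1
  have hPinj : Function.Injective P := by
    rw [injective_iff_map_eq_zero]
    intro p hp
    exact (hind 0 0 p (by simp [hp])).2.2
  have hA := isSelfAdjointPair_shear J hP (LinearMap.IsSymmetric.zero (𝕜 := ℂ))
  have hB := isSelfAdjointPair_shear J hS hW
  have hYA := injective_shearDomain J hPinj 0
  have hXA := injective_shearRange J hPinj 0
  have hYB := injective_shearDomain J hSinj W
  have hXB := injective_shearRange J hSinj W
  refine ⟨quotient (shearDomain J P 0) (shearRange J P 0),
    quotient (shearDomain J S W) (shearRange J S W), hA.isSelfAdjoint hYA,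
    injective_quotient hYA hXA, ?_, ?_, hB.isSelfAdjoint hYB, injective_quotient hYB hXB, ?_⟩
  · rw [inverse_quotient hYA hXA]
    exact hA.swap.isSelfAdjoint hXA
  · rw [inverse_quotient hYA hXA]
    exact injective_quotient hXA hYA
  rw [inverse_quotient hYA hXA, inverse_quotient hYB hXB]
  refine ⟨hB.swap.isSelfAdjoint hXB, ?_, ?_, ?_⟩
  · rw [Submodule.eq_bot_iff]
    rintro x ⟨hxA, hxB⟩
    obtain ⟨⟨a, b⟩, rfl⟩ := (mem_domain_quotient _ _ _).1 hxA
    obtain ⟨⟨c, d⟩, h⟩ := (mem_domain_quotient _ _ _).1 hxB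
    simp only [shearDomain_apply, toLp_inj, LinearMap.zero_apply, add_zero] at h
    obtain ⟨h, rfl⟩ := h
    obtain ⟨rfl, rfl, ha⟩ := hind d c (-a) (by rw [map_neg, ← h]; abel)
    rw [neg_eq_zero.1 ha]
    exact map_zero _
  · rw [Submodule.eq_bot_iff]
    rintro x ⟨hxA, hxB⟩
    obtain ⟨⟨a, b⟩, rfl⟩ := (mem_domain_quotient _ _ _).1 hxA
    obtain ⟨⟨c, d⟩, h⟩ := (mem_domain_quotient _ _ _).1 hxB
    simp only [shearRange_apply, toLp_inj, LinearMap.zero_apply, sub_zero] at h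
    obtain ⟨rfl, h⟩ := h
    obtain ⟨hc, rfl, hb⟩ := hind (-c) d (-b) (by rw [map_neg, map_neg, ← h]; abel)
    rw [neg_eq_zero.1 hc, neg_eq_zero.1 hb]
    exact map_zero _
  · -- All vectors `J (k, 0)` lie in `D((A⁻¹)²)`, but only those with `k ∈ ran S` lie in `D(B)`;
    -- any nonzero `k ∈ ran W` therefore works.
    obtain ⟨y, hy⟩ : ∃ y : SeqSpace, y ≠ 0 :=
      ⟨lp.single 2 0 1, fun h => by simpa using congrArg (fun f : SeqSpace => f 0) h⟩
    have hX (k : SeqSpace) : shearRange J P 0 (k, 0) = J (WithLp.toLp 2 (k, 0)) := by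
      simp [shearRange_apply]
    have hY (k : SeqSpace) : shearDomain J P 0 (k, 0) = J (WithLp.toLp 2 (P k, 0)) := by
      simp [shearDomain_apply]
    refine ⟨J (WithLp.toLp 2 (W y, 0)), ?_, ?_⟩
    · rw [← hX, mem_mul_domain]
      refine ⟨(mem_domain_quotient _ _ _).2 ⟨_, rfl⟩, ?_⟩
      rw [quotient_apply hXA, mem_domain_quotient, hY]
      exact ⟨_, hX _⟩
    · intro hmem
      obtain ⟨⟨c, d⟩, h⟩ := (mem_domain_quotient _ _ _).1 hmem
      simp only [shearDomain_apply, toLp_inj] at h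
      obtain ⟨h, rfl⟩ := h
      rw [map_zero, add_zero] at h
      exact hy (hind y (-c) 0 (by rw [map_neg, h, map_zero]; abel)).1

/-- For self-adjoint `R`, `S` the domains of `T T*` and `T* T`, `T = (0, S; R, 0)`, are
`D(S²) ⊕ D(R²)` and `D(R²) ⊕ D(S²)`, which differ if `D(S²)` is not contained in `D(R)`. -/
theorem not_isNormal_offDiagonal {E : Type*} [NormedAddCommGroup E] [InnerProductSpace ℂ E]
    [CompleteSpace E] {S R : E →ₗ.[ℂ] E} (hS : IsSelfAdjoint S) (hR : IsSelfAdjoint R)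
    {x : E} (hx : x ∈ (mul S S).domain) (hxR : x ∉ R.domain) :
    ¬ IsNormal (offDiagonal S R) := by
  rintro ⟨-, -, h⟩
  rw [adjoint_offDiagonal hS.dense_domain hR.dense_domain, LinearPMap.isSelfAdjoint_def.mp hS,
    LinearPMap.isSelfAdjoint_def.mp hR] at h
  obtain ⟨hx₁, hx₂⟩ := hx
  have hmem : WithLp.toLp 2 (x, 0) ∈ (mul (offDiagonal S R) (offDiagonal R S)).domain := by
    refine ⟨⟨hx₁, R.domain.zero_mem⟩, ?_, hx₂⟩
    change R 0 ∈ R.domain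
    rw [LinearPMap.map_zero]
    exact R.domain.zero_mem
  rw [h] at hmem
  exact hxR hmem.1.1

end UnboundedOperator

end

theorem mainTheorem1 :
    ∃ (A B : UnboundedOperator.L2R →ₗ.[ℂ] UnboundedOperator.L2R)
      (T : UnboundedOperator.L2RSum →ₗ.[ℂ] UnboundedOperator.L2RSum),
      -- `A` and `B` are one-to-one self-adjoint operators, unbounded, with unbounded inverses
      (IsSelfAdjoint A ∧ Function.Injective A.toFun ∧
        ¬ UnboundedOperator.IsBounded A ∧ ¬ UnboundedOperator.IsBounded A.inverse) ∧
      (IsSelfAdjoint B ∧ Function.Injective B.toFun ∧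
        ¬ UnboundedOperator.IsBounded B ∧ ¬ UnboundedOperator.IsBounded B.inverse) ∧
      -- the domains intersect trivially
      A.domain ⊓ B.domain = ⊥ ∧ A.inverse.domain ⊓ B.inverse.domain = ⊥ ∧
      -- the operator matrix
      T = UnboundedOperator.offDiagonal A.inverse B ∧
      -- its properties
      Dense (T.domain : Set UnboundedOperator.L2RSum) ∧ T.IsClosed ∧
      Function.Injective T.toFun ∧ Function.Injective T.adjoint.toFun ∧
      (UnboundedOperator.mul T T).domain = ⊥ ∧
      (UnboundedOperator.mul T.adjoint T.adjoint).domain = ⊥ ∧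
      UnboundedOperator.IsParanormal T ∧ UnboundedOperator.IsParanormal T.adjoint ∧
      ¬ UnboundedOperator.IsNormal T := by
  obtain ⟨A, B, hA, hAi, hA', hAi', hB, hBi, hB', hAB, hAB', x, hx, hxB⟩ :=
    UnboundedOperator.exists_selfAdjoint_pair
  have : Nontrivial UnboundedOperator.L2R := by
    by_contra hn
    rw [not_nontrivial_iff_subsingleton] at hn
    exact UnboundedOperator.not_finiteDimensional_L2R inferInstance
  have hadj : (UnboundedOperator.offDiagonal A.inverse B).adjoint =
      UnboundedOperator.offDiagonal B A.inverse := by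
    rw [UnboundedOperator.adjoint_offDiagonal hA'.dense_domain hB.dense_domain,
      LinearPMap.isSelfAdjoint_def.mp hA', LinearPMap.isSelfAdjoint_def.mp hB]
  have hadj' : (UnboundedOperator.offDiagonal B A.inverse).adjoint =
      UnboundedOperator.offDiagonal A.inverse B := by
    rw [UnboundedOperator.adjoint_offDiagonal hB.dense_domain hA'.dense_domain,
      LinearPMap.isSelfAdjoint_def.mp hA', LinearPMap.isSelfAdjoint_def.mp hB]
  have hrB : LinearMap.range B.toFun ⊓ A.inverse.domain = ⊥ := by
    rw [← LinearPMap.inverse_domain, inf_comm]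
    exact hAB'
  have hrA : LinearMap.range A.inverse.toFun ⊓ B.domain = ⊥ := by
    rw [LinearPMap.inverse_range (LinearMap.ker_eq_bot.2 hAi)]
    exact hAB
  have hsq := UnboundedOperator.domain_mul_offDiagonal_eq_bot hAi' hBi hrB hrA
  have hsq' := UnboundedOperator.domain_mul_offDiagonal_eq_bot hBi hAi' hrA hrB
  refine ⟨A, B, UnboundedOperator.offDiagonal A.inverse B,
    ⟨hA, hAi, UnboundedOperator.not_isBounded_of_domain_inf_eq_bot hA hB hAB,
      UnboundedOperator.not_isBounded_of_domain_inf_eq_bot hA' hB' hAB'⟩,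
    ⟨hB, hBi, UnboundedOperator.not_isBounded_of_domain_inf_eq_bot hB hA ((inf_comm _ _).trans hAB),
      UnboundedOperator.not_isBounded_of_domain_inf_eq_bot hB' hA' ((inf_comm _ _).trans hAB')⟩,
    hAB, hAB', rfl,
    UnboundedOperator.dense_domain_offDiagonal hA'.dense_domain hB.dense_domain, ?_,
    UnboundedOperator.injective_offDiagonal hAi' hBi, ?_, hsq, ?_,
    UnboundedOperator.isParanormal_of_domain_mul_eq_bot hsq, ?_,
    UnboundedOperator.not_isNormal_offDiagonal hA' hB hx hxB⟩
  · rw [← hadj']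
    exact LinearPMap.adjoint_isClosed
      (UnboundedOperator.dense_domain_offDiagonal hB.dense_domain hA'.dense_domain)
  · rw [hadj]
    exact UnboundedOperator.injective_offDiagonal hBi hAi'
  · rw [hadj]
    exact hsq'
  · rw [hadj]
    exact UnboundedOperator.isParanormal_of_domain_mul_eq_bot hsq'
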